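/- A \emph{continuum} is a nonempty compact connected metric space, and a subcontinuum of $X$ is a nonempty compact connected subset of $X$. For a continuum $X$ and $x\in X$, the \emph{meager composant} of $x$ in $X$ is $$M_x=\bigcup\{L\subset X : L\text{ is a nowhere dense subcontinuum of }X\text{ and }x\in L\},$$ and the meager composants of $X$ are the sets $M_x$ with $x\in X$. A continuum $X$ is \emph{chainable} if for every $\varepsilon>0$ there are finitely many open sets $U_1,\dots,U_n$ covering $X$ such that $\operatorname{diam}(U_i)<\varepsilon$ for all $i\le n$ and, for all $i,j\le n$, $U_i\cap U_j\neq\varnothing$ if and only if $|i-j|\le 1$. \textbf{Corollary 16.} Let $X$ be a chainable continuum with more than one point. Then $X$ has exactly $2^{\aleph_0}$ meager composants, that is, the set $\{M_x : x\in X\}$ has cardinality $2^{\aleph_0}$. -/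

import Mathlib

namespace Continuum

/-- A subcontinuum of a metric space `X`: a nonempty, compact and connected subset
(`IsConnected` includes nonemptiness; singletons are allowed). -/
def IsSubcontinuum {X : Type*} [MetricSpace X] (L : Set X) : Prop :=
  IsCompact L ∧ IsConnected L

/-- The meager composant `M_x` of the point `x` in `X`: the union of all nowhere dense
subcontinua of `X` that contain `x`. -/
def meagerComposant {X : Type*} [MetricSpace X] (x : X) : Set X :=
  ⋃₀ {L : Set X | IsSubcontinuum L ∧ IsNowhereDense L ∧ x ∈ L}

/-- The family of all meager composants of `X`, as a set of subsets of `X`. -/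
def meagerComposants (X : Type*) [MetricSpace X] : Set (Set X) :=
  {M : Set X | ∃ x : X, M = meagerComposant x}

/-- Chainability: for every `ε > 0` there is a finite open cover `U_0, …, U_{n-1}` by sets of
diameter less than `ε` such that `U_i ∩ U_j ≠ ∅` if and only if `|i - j| ≤ 1`. -/
def IsChainable (X : Type*) [MetricSpace X] : Prop :=
  ∀ ε : ℝ, 0 < ε → ∃ (n : ℕ) (U : Fin n → Set X),
    (∀ i, IsOpen (U i)) ∧
    (⋃ i, U i) = Set.univ ∧
    (∀ i, Metric.diam (U i) < ε) ∧
    (∀ i j, (U i ∩ U j).Nonempty ↔ |(i : ℤ) - (j : ℤ)| ≤ 1)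

end Continuum

/-! A compact metric space has at most `2^ℵ₀` points, which gives the upper bound. As `x ∈ M_x`, the
lower bound follows from a family of points indexed by `ℕ → Bool`, no two of which lie in a common
nowhere dense continuum.

Suppose some nonempty open `W` lies in every continuum whose interior meets `W`. For each basic open
`B ⊆ W`, being joined by a continuum that misses `B` is then a closed relation containing no open
box in `W`, and Mycielski's theorem (`exists_independent_cantor`) yields the family.

Otherwise every continuum with interior contains two such continua that no nowhere dense continuum
joins (`ChainSeq.exists_notThinlyJoined`). Iteration gives a binary tree, with one point chosen on
each branch. Only this case uses chainability: limits of runs of links along an ultrafilter are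
connected, which gives unicoherence, a splitting of differences of continua, and a linear preorder
in which continua are convex. -/

open Set Filter Topology

/-! ### Chain covers and ultrafilter limits of runs of links -/

/-- A sequence of chain covers, indexed by `ℕ` (with `U n i = ∅` for large `i`), the links of the
`n`-th one having diameter at most `1 / (n + 1)`. -/
structure ChainSeq {X : Type*} [MetricSpace X] (U : ℕ → ℕ → Set X) : Prop where
  isOpen : ∀ n i, IsOpen (U n i)
  cover : ∀ n x, ∃ i, x ∈ U n i
  dist_le : ∀ n i x y, x ∈ U n i → y ∈ U n i → dist x y ≤ 1 / ((n : ℝ) + 1)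
  inter : ∀ n i j x, x ∈ U n i → x ∈ U n j → i ≤ j + 1
  succ_inter : ∀ n i, (U n i).Nonempty → (U n (i + 1)).Nonempty → (U n i ∩ U n (i + 1)).Nonempty
  nonempty_of_le : ∀ n i j, i ≤ j → (U n j).Nonempty → (U n i).Nonempty

theorem Continuum.IsChainable.exists_chainSeq {X : Type*} [MetricSpace X] [CompactSpace X]
    (hX : Continuum.IsChainable X) : ∃ U : ℕ → ℕ → Set X, ChainSeq U := by
  have h : ∀ n : ℕ, (0 : ℝ) < 1 / ((n : ℝ) + 1) := fun n => by positivity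
  choose N U hopen hcov hdiam hint using fun n => hX _ (h n)
  have hne : ∀ n i, (U n i).Nonempty := fun n i => by
    have := (hint n i i).2 (by simp)
    simpa using this
  refine ⟨fun n i => if hi : i < N n then U n ⟨i, hi⟩ else ∅, ?_, ?_, ?_, ?_, ?_, ?_⟩
  · intro n i
    split_ifs
    exacts [hopen _ _, isOpen_empty]
  · intro n x
    have : x ∈ ⋃ i, U n i := by rw [hcov]; trivial
    obtain ⟨i, hi⟩ := mem_iUnion.1 this
    exact ⟨i, by simpa using hi⟩
  · intro n i x y hx hy
    beta_reduce at hx hy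
    split_ifs at hx hy with hi
    · exact (Metric.dist_le_diam_of_mem (Metric.isBounded_of_compactSpace) hx hy).trans
        (hdiam n _).le
    · exact hx.elim
  · intro n i j x hx hy
    beta_reduce at hx hy
    split_ifs at hx hy with hi hj
    · have := (hint n ⟨i, hi⟩ ⟨j, hj⟩).1 ⟨x, hx, hy⟩
      rw [abs_le] at this
      simp only at this
      omega
    · exact hy.elim
    · exact hx.elim
    · exact hx.elim
  · intro n i hi hj
    beta_reduce at hi hj ⊢
    split_ifs at hi hj ⊢ with h1 h2
    · exact (hint n _ _).2 (by simp)
    · simp at hj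
    · simp at hi
    · simp at hi
  · intro n i j hij hj
    beta_reduce at hj ⊢
    split_ifs at hj with h1
    · rw [dif_pos (hij.trans_lt h1)]
      exact hne _ _
    · simp at hj

/-- The limit, along a free ultrafilter, of the unions of the links with index in `J n`. -/
def linkLimit {X : Type*} [MetricSpace X] (U : ℕ → ℕ → Set X) (J : ℕ → Set ℕ) : Set X :=
  {x | ∀ ε > 0, ∀ᶠ n in (hyperfilter ℕ : Filter ℕ), ∃ i ∈ J n, ∃ y ∈ U n i, dist y x < ε}

/-- The indices of the links that meet `L`. -/
def linkRange {X : Type*} (U : ℕ → ℕ → Set X) (L : Set X) (n : ℕ) : Set ℕ :=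
  {i | (U n i ∩ L).Nonempty}

theorem eventually_one_div_lt {ε : ℝ} (hε : 0 < ε) :
    ∀ᶠ n : ℕ in (hyperfilter ℕ : Filter ℕ), 1 / ((n : ℝ) + 1) < ε :=
  (Nat.hyperfilter_le_atTop) ((tendsto_one_div_add_atTop_nhds_zero_nat).eventually_lt_const hε)

section
variable {X : Type*} [MetricSpace X] {U : ℕ → ℕ → Set X}

theorem isClosed_linkLimit (U : ℕ → ℕ → Set X) (J : ℕ → Set ℕ) : IsClosed (linkLimit U J) := by
  refine isClosed_of_closure_subset fun x hx ε hε => ?_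
  obtain ⟨z, hz, hxz⟩ := Metric.mem_closure_iff.1 hx (ε / 2) (half_pos hε)
  filter_upwards [hz (ε / 2) (half_pos hε)] with n ⟨i, hi, y, hy, hd⟩
  refine ⟨i, hi, y, hy, ?_⟩
  have := dist_triangle y z x
  rw [dist_comm] at hxz
  linarith

/-- If link `k` missed `L`, the links before `k` and those after `k` would separate `L`, since links
whose indices differ by at least two are disjoint. -/
theorem ChainSeq.ordConnected_linkRange (hU : ChainSeq U) {L : Set X} (hL : IsPreconnected L)
    (n : ℕ) : (linkRange U L n).OrdConnected := by
  refine ⟨fun i hi j hj k hk => ?_⟩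
  by_contra hkL
  obtain ⟨x, hxi, hxL⟩ := hi
  obtain ⟨y, hyj, hyL⟩ := hj
  have hne : ∀ w ∈ L, w ∉ U n k := fun w hw hwk => hkL ⟨w, hwk, hw⟩
  have hik : i < k := lt_of_le_of_ne hk.1 (by rintro rfl; exact hne x hxL hxi)
  have hkj : k < j := lt_of_le_of_ne hk.2 (by rintro rfl; exact hne y hyL hyj)
  obtain ⟨w, hwL, hw1, hw2⟩ := hL (⋃ m ∈ {m | m < k}, U n m) (⋃ m ∈ {m | k < m}, U n m)
    (isOpen_biUnion fun _ _ => hU.isOpen _ _) (isOpen_biUnion fun _ _ => hU.isOpen _ _)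
    (fun w hw => by
      obtain ⟨m, hm⟩ := hU.cover n w
      rcases lt_trichotomy m k with h | h | h
      · exact Or.inl (mem_biUnion (by exact h) hm)
      · exact (hne w hw (h ▸ hm)).elim
      · exact Or.inr (mem_biUnion (by exact h) hm))
    ⟨x, hxL, mem_biUnion (by exact hik) hxi⟩ ⟨y, hyL, mem_biUnion (by exact hkj) hyj⟩
  simp only [mem_iUnion, Set.mem_ofPred_eq] at hw1 hw2
  obtain ⟨m, hm, hwm⟩ := hw1
  obtain ⟨m', hm', hwm'⟩ := hw2
  have := hU.inter n _ _ w hwm' hwm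
  omega

theorem ChainSeq.linkLimit_subset (hU : ChainSeq U) {L : Set X} (hL : IsClosed L)
    {J : ℕ → Set ℕ} (hJ : ∀ n, J n ⊆ linkRange U L n) : linkLimit U J ⊆ L := by
  intro x hx
  rw [← hL.closure_eq, Metric.mem_closure_iff]
  intro ε hε
  obtain ⟨n, ⟨i, hi, y, hy, hd⟩, hn⟩ :=
    ((hx (ε / 2) (half_pos hε)).and (eventually_one_div_lt (half_pos hε))).exists
  obtain ⟨w, hwi, hwL⟩ := hJ n hi
  refine ⟨w, hwL, ?_⟩
  have h1 := hU.dist_le n i y w hy hwi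
  have h2 := dist_triangle_left x w y
  linarith

theorem mem_linkLimit_of_eventually {J : ℕ → Set ℕ} {x : X}
    (h : ∀ᶠ n in (hyperfilter ℕ : Filter ℕ), ∃ i ∈ J n, x ∈ U n i) : x ∈ linkLimit U J := by
  intro ε hε
  filter_upwards [h] with n ⟨i, hi, hx⟩
  exact ⟨i, hi, x, hx, by simpa using hε⟩

/-- Sets approximating a link limit end up in each of its neighbourhoods. -/
theorem linkLimit_eventually_subset [CompactSpace X] {J : ℕ → Set ℕ} {V : Set X} (hV : IsOpen V)
    (h : linkLimit U J ⊆ V) :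
    ∀ᶠ n in (hyperfilter ℕ : Filter ℕ), ∀ i ∈ J n, U n i ⊆ V := by
  by_contra hcon
  rw [← Ultrafilter.eventually_not] at hcon
  have h1 : ∀ n, ∃ y : X, (¬ ∀ i ∈ J n, U n i ⊆ V) → (∃ i ∈ J n, y ∈ U n i) ∧ y ∉ V := by
    intro n
    by_cases hn : ∀ i ∈ J n, U n i ⊆ V
    -- Here `y n` may be arbitrary; another index only serves to show that `X` has a point.
    · obtain ⟨n', hn'⟩ := hcon.exists
      push Not at hn'
      obtain ⟨i, -, hi⟩ := hn'
      obtain ⟨y, -⟩ := not_subset.1 hi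
      exact ⟨y, fun h' => (h' hn).elim⟩
    · have hn' := hn
      push Not at hn'
      obtain ⟨i, hi, hi'⟩ := hn'
      obtain ⟨y, hy, hyV⟩ := not_subset.1 hi'
      exact ⟨y, fun _ => ⟨⟨i, hi, hy⟩, hyV⟩⟩
  choose y hy using h1
  obtain ⟨x, -, hx⟩ := isCompact_univ.ultrafilter_le_nhds ((hyperfilter ℕ).map y) (by simp)
  have hx' : Tendsto y (hyperfilter ℕ : Filter ℕ) (𝓝 x) := hx
  have hxV : x ∉ V := by
    intro hxV
    obtain ⟨n, hn, hn'⟩ := ((hx'.eventually (hV.mem_nhds hxV)).and hcon).exists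
    exact (hy n hn').2 hn
  refine hxV (h fun ε hε => ?_)
  filter_upwards [hcon, hx'.eventually (Metric.ball_mem_nhds x hε)] with n hn hn'
  obtain ⟨i, hi, hyi⟩ := (hy n hn).1
  exact ⟨i, hi, y n, hyi, hn'⟩

/-- A run of consecutive links covered by two separated sets stays in the one it starts in. -/
theorem ChainSeq.subset_thickening_of_le (hU : ChainSeq U) {P Q : Set X} {δ : ℝ} {n : ℕ}
    (hn : 1 / ((n : ℝ) + 1) < δ) (hPQ : Disjoint (Metric.thickening (δ + δ) P)
      (Metric.thickening (δ + δ) Q)) {i j : ℕ} (hij : i ≤ j)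
    (h : ∀ k, i ≤ k → k ≤ j → U n k ⊆ Metric.thickening δ P ∪ Metric.thickening δ Q)
    (hi : (U n i ∩ Metric.thickening δ P).Nonempty) (hj : (U n j).Nonempty) :
    U n j ⊆ Metric.thickening (δ + δ) P := by
  have hδ : 0 < δ := lt_trans (by positivity) hn
  have key : ∀ k, (U n k ∩ Metric.thickening δ P).Nonempty →
      U n k ⊆ Metric.thickening (δ + δ) P := by
    rintro k ⟨y, hyk, hyP⟩ x hx
    rw [Metric.mem_thickening_iff] at hyP ⊢
    obtain ⟨z, hz, hyz⟩ := hyP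
    refine ⟨z, hz, ?_⟩
    have h1 := hU.dist_le n k x y hx hyk
    have h2 := dist_triangle x y z
    linarith
  refine key j ?_
  induction j, hij using Nat.le_induction with
  | base => exact hi
  | succ k hik ih =>
    have hk : (U n k).Nonempty := hU.nonempty_of_le n _ _ (Nat.le_succ k) hj
    have hkP := key k (ih (fun m h1 h2 => h m h1 (h2.trans (Nat.le_succ k))) hk)
    -- Consecutive links share a point `w`, and near `P` it cannot also be near `Q`.
    obtain ⟨w, hw, hw'⟩ := hU.succ_inter n k hk hj
    refine ⟨w, hw', (h (k + 1) (by omega) le_rfl hw').resolve_right fun hwQ => ?_⟩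
    exact disjoint_left.1 hPQ (hkP hw) (Metric.thickening_mono (by linarith) _ hwQ)

/-- A separation of the limit into `P` and `Q` would show at one fine stage: a run of small links,
all near `P ∪ Q`, would pass from one set to the other without crossing the gap. -/
theorem ChainSeq.isPreconnected_linkLimit [CompactSpace X] (hU : ChainSeq U) {J : ℕ → Set ℕ}
    (hJ : ∀ n, (J n).OrdConnected) : IsPreconnected (linkLimit U J) := by
  rw [isPreconnected_iff_subset_of_fully_disjoint_closed (isClosed_linkLimit U J)]
  intro P Q hP hQ hPQ hdis
  by_contra! hcon
  obtain ⟨⟨q, hq, hqP⟩, ⟨p, hp, hpQ⟩⟩ := And.imp not_subset.1 not_subset.1 hcon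
  have hpP : p ∈ P := (hPQ hp).resolve_right hpQ
  have hqQ : q ∈ Q := (hPQ hq).resolve_left hqP
  obtain ⟨δ', hδ', hgap'⟩ := hdis.exists_thickenings hP.isCompact hQ
  obtain ⟨δ, hδ, hgap⟩ : ∃ δ > 0, Disjoint (Metric.thickening (δ + δ) P)
      (Metric.thickening (δ + δ) Q) := ⟨δ' / 2, half_pos hδ', by rwa [add_halves]⟩
  have hsub : linkLimit U J ⊆ Metric.thickening δ P ∪ Metric.thickening δ Q :=
    hPQ.trans (union_subset_union (Metric.self_subset_thickening hδ _)
      (Metric.self_subset_thickening hδ _))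
  obtain ⟨n, ⟨hn, hsubn⟩, ⟨i, hi, x, hx, hxp⟩, ⟨j, hj, y, hy, hyq⟩⟩ :=
    (((eventually_one_div_lt hδ).and (linkLimit_eventually_subset
      (Metric.isOpen_thickening.union Metric.isOpen_thickening) hsub)).and
        ((hp δ hδ).and (hq δ hδ))).exists
  have hxP : x ∈ Metric.thickening δ P := Metric.mem_thickening_iff.2 ⟨p, hpP, hxp⟩
  have hyQ : y ∈ Metric.thickening δ Q := Metric.mem_thickening_iff.2 ⟨q, hqQ, hyq⟩
  rcases le_total i j with hij | hij
  · have := hU.subset_thickening_of_le hn hgap hij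
      (fun k h1 h2 => hsubn k ((hJ n).out hi hj ⟨h1, h2⟩)) ⟨x, hx, hxP⟩ ⟨y, hy⟩
    exact disjoint_left.1 hgap (this hy) (Metric.thickening_mono (by linarith) _ hyQ)
  · have := hU.subset_thickening_of_le hn hgap.symm hij
      (fun k h1 h2 => union_comm (Metric.thickening δ P) _ ▸
        hsubn k ((hJ n).out hj hi ⟨h1, h2⟩)) ⟨y, hy, hyQ⟩ ⟨x, hx⟩
    exact disjoint_left.1 hgap (Metric.thickening_mono (by linarith) _ hxP) (this hx)

/-- Chainable continua are hereditarily unicoherent. -/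
theorem ChainSeq.isPreconnected_inter [CompactSpace X] (hU : ChainSeq U) {K L : Set X}
    (hK : IsClosed K) (hK' : IsPreconnected K) (hL : IsClosed L) (hL' : IsPreconnected L) :
    IsPreconnected (K ∩ L) := by
  -- A link meeting both `K` and `L` may miss `K ∩ L`, but this error vanishes in the limit. The
  -- intersection of two runs is a run.
  have : K ∩ L = linkLimit U fun n => linkRange U K n ∩ linkRange U L n := by
    refine Subset.antisymm (fun x hx => mem_linkLimit_of_eventually (Eventually.of_forall
      fun n => ?_)) (subset_inter (hU.linkLimit_subset hK fun n => inter_subset_left)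
        (hU.linkLimit_subset hL fun n => inter_subset_right))
    obtain ⟨i, hi⟩ := hU.cover n x
    exact ⟨i, ⟨⟨x, hi, hx.1⟩, x, hi, hx.2⟩, hi⟩
  rw [this]
  exact hU.isPreconnected_linkLimit fun n =>
    (hU.ordConnected_linkRange hK' n).inter (hU.ordConnected_linkRange hL' n)

theorem disjoint_interior_linkLimit {L : Set X} {J : ℕ → Set ℕ}
    (hJ : ∀ n, Disjoint (J n) (linkRange U L n)) : Disjoint (linkLimit U J) (interior L) := by
  refine disjoint_left.2 fun x hx hxL => ?_
  obtain ⟨ε, hε, hball⟩ := Metric.mem_nhds_iff.1 (mem_interior_iff_mem_nhds.1 hxL)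
  obtain ⟨n, i, hi, y, hy, hd⟩ := (hx ε hε).exists
  exact disjoint_left.1 (hJ n) hi ⟨y, hy, hball hd⟩

/-- In a chainable continuum, the difference of two continua is covered by two subcontinua of the
first that do not meet the interior of the second. -/
theorem ChainSeq.exists_diff_subset_union [CompactSpace X] (hU : ChainSeq U) {K L : Set X}
    (hK : IsClosed K) (hK' : IsPreconnected K) (hL : IsClosed L) (hL' : IsPreconnected L)
    (hne : L.Nonempty) :
    ∃ A B : Set X, (IsClosed A ∧ IsPreconnected A ∧ A ⊆ K ∧ Disjoint A (interior L)) ∧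
      (IsClosed B ∧ IsPreconnected B ∧ B ⊆ K ∧ Disjoint B (interior L)) ∧ K \ L ⊆ A ∪ B := by
  have hl : ∀ n, ∃ i, i ∈ linkRange U L n := fun n => by
    obtain ⟨x, hx⟩ := hne
    obtain ⟨i, hi⟩ := hU.cover n x
    exact ⟨i, x, hi, hx⟩
  -- The two continua are the limits of the links of `K` before, respectively after, all links
  -- meeting `L`.
  refine ⟨linkLimit U fun n => linkRange U K n ∩ {i | ∀ j ∈ linkRange U L n, i < j},
    linkLimit U fun n => linkRange U K n ∩ {i | ∀ j ∈ linkRange U L n, j < i},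
    ⟨isClosed_linkLimit _ _, hU.isPreconnected_linkLimit fun n =>
      (hU.ordConnected_linkRange hK' n).inter ⟨fun a ha b hb c hc j hj => hc.2.trans_lt (hb j hj)⟩,
      hU.linkLimit_subset hK fun n => inter_subset_left,
      disjoint_interior_linkLimit fun n => disjoint_left.2 fun i hi hi' =>
        lt_irrefl _ (hi.2 i hi')⟩,
    ⟨isClosed_linkLimit _ _, hU.isPreconnected_linkLimit fun n =>
      (hU.ordConnected_linkRange hK' n).inter
        ⟨fun a ha b hb c hc j hj => (ha j hj).trans_le hc.1⟩,
      hU.linkLimit_subset hK fun n => inter_subset_left,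
      disjoint_interior_linkLimit fun n => disjoint_left.2 fun i hi hi' =>
        lt_irrefl _ (hi.2 i hi')⟩, ?_⟩
  rintro x ⟨hxK, hxL⟩
  obtain ⟨ε, hε, hball⟩ := Metric.mem_nhds_iff.1 (hL.isOpen_compl.mem_nhds hxL)
  have h : ∀ᶠ n in (hyperfilter ℕ : Filter ℕ),
      (∃ i ∈ linkRange U K n ∩ {i | ∀ j ∈ linkRange U L n, i < j}, x ∈ U n i) ∨
      (∃ i ∈ linkRange U K n ∩ {i | ∀ j ∈ linkRange U L n, j < i}, x ∈ U n i) := by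
    filter_upwards [eventually_one_div_lt hε] with n hn
    obtain ⟨i, hi⟩ := hU.cover n x
    have hiL : i ∉ linkRange U L n := by
      rintro ⟨y, hy, hyL⟩
      exact hball (Metric.mem_ball.2 ((hU.dist_le n i y x hy hi).trans_lt hn)) hyL
    obtain ⟨m, hm⟩ := hl n
    have hoc := hU.ordConnected_linkRange hL' n
    have hmi : m ≠ i := by rintro rfl; exact hiL hm
    rcases lt_or_gt_of_ne hmi with hmi | hmi
    · refine Or.inr ⟨i, ⟨⟨x, hi, hxK⟩, fun j hj => ?_⟩, hi⟩
      by_contra! hji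
      exact hiL (hoc.out hm hj ⟨hmi.le, hji⟩)
    · refine Or.inl ⟨i, ⟨⟨x, hi, hxK⟩, fun j hj => ?_⟩, hi⟩
      by_contra! hji
      exact hiL (hoc.out hj hm ⟨hji, hmi.le⟩)
  -- The ultrafilter decides on which side of `L` the point lies.
  exact (Ultrafilter.eventually_or.1 h).imp mem_linkLimit_of_eventually
    mem_linkLimit_of_eventually

/-- The points of a chainable continuum can be linearly ordered (with ties) so that all its
subcontinua are convex. -/
theorem ChainSeq.exists_convex_order (hU : ChainSeq U) :
    ∃ (R : Type) (_ : LinearOrder R) (φ : X → R), ∀ L : Set X, IsClosed L → IsPreconnected L →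
      ∀ x ∈ L, ∀ y ∈ L, ∀ z, φ x ≤ φ z → φ z ≤ φ y → z ∈ L := by
  choose p hp using hU.cover
  -- Points are compared by their link indices in an ultrapower of `ℕ`, which is linearly ordered.
  refine ⟨Germ (hyperfilter ℕ : Filter ℕ) ℕ, inferInstance,
    fun x => ((fun n => p n x : ℕ → ℕ) : Germ (hyperfilter ℕ : Filter ℕ) ℕ), ?_⟩
  intro L hL hL' x hx y hy z hxz hzy
  refine hU.linkLimit_subset (J := linkRange U L) hL (fun n => le_rfl)
    (mem_linkLimit_of_eventually ?_)
  filter_upwards [Germ.coe_le.1 hxz, Germ.coe_le.1 hzy] with n h1 h2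
  exact ⟨p n z, (hU.ordConnected_linkRange hL' n).out ⟨x, hp n x, hx⟩ ⟨y, hp n y, hy⟩ ⟨h1, h2⟩,
    hp n z⟩
end

/-! ### Cantor schemes and Mycielski's theorem -/

/-- In each level of a binary tree of decreasing nonempty closed sets there is a common point of
every branch. -/
theorem exists_branch_points {X : Type*} [TopologicalSpace X] [CompactSpace X]
    (C : (n : ℕ) → (Fin n → Bool) → Set X) (hcl : ∀ n s, IsClosed (C n s))
    (hne : ∀ n s, (C n s).Nonempty) (hsub : ∀ n s, C (n + 1) s ⊆ C n (fun i => s i.castSucc)) :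
    ∃ f : (ℕ → Bool) → X, ∀ a n, f a ∈ C n (fun i => a i) := by
  have h : ∀ a : ℕ → Bool, (⋂ n, C n (fun i => a i)).Nonempty := fun a =>
    IsCompact.nonempty_iInter_of_sequence_nonempty_isCompact_isClosed _
      (fun n => hsub n _) (fun n => hne n _) (hcl _ _).isCompact (fun n => hcl _ _)
  choose f hf using h
  exact ⟨f, fun a n => mem_iInter.1 (hf a) n⟩

theorem restrict_ne_of_ne {a b : ℕ → Bool} (hab : a ≠ b) :
    ∃ N, ∀ n, N ≤ n → (fun i : Fin n => a i) ≠ fun i : Fin n => b i := by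
  obtain ⟨k, hk⟩ := Function.ne_iff.1 hab
  exact ⟨k + 1, fun n hn h => hk (congrFun h ⟨k, hn⟩)⟩

/-- Finitely many open sets may be shrunk so as to avoid, pairwise, a relation that contains no
open box. -/
theorem exists_shrink_avoiding {X ι : Type*} [TopologicalSpace X] [Finite ι] {W : Set X}
    {R : Set (X × X)} (hR : IsClosed R)
    (hbox : ∀ P Q : Set X, IsOpen P → IsOpen Q → P.Nonempty → Q.Nonempty → P ⊆ W → Q ⊆ W →
      ¬ P ×ˢ Q ⊆ R)
    (V : ι → Set X) (hV : ∀ i, IsOpen (V i) ∧ (V i).Nonempty ∧ V i ⊆ W) :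
    ∃ V' : ι → Set X, (∀ i, IsOpen (V' i) ∧ (V' i).Nonempty ∧ V' i ⊆ V i) ∧
      ∀ i j, i ≠ j → Disjoint (V' i ×ˢ V' j) R := by
  classical
  -- Induction on the set of pairs already treated; later shrinking preserves disjointness from `R`.
  have key : ∀ S : Set (ι × ι), ∃ V' : ι → Set X,
      (∀ i, IsOpen (V' i) ∧ (V' i).Nonempty ∧ V' i ⊆ V i) ∧
      ∀ i j, (i, j) ∈ S → i ≠ j → Disjoint (V' i ×ˢ V' j) R := by
    intro S
    induction S, S.toFinite using Set.Finite.induction_on with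
    | empty => exact ⟨V, fun i => ⟨(hV i).1, (hV i).2.1, le_rfl⟩, fun i j h => h.elim⟩
    | @insert p S _ _ ih =>
      obtain ⟨V', hV', hdis⟩ := ih
      obtain ⟨i, j⟩ := p
      by_cases hij : i = j
      · refine ⟨V', hV', fun k l h hkl => ?_⟩
        rcases h with h | h
        · simp only [Prod.mk.injEq] at h
          exact (hkl (by rw [h.1, h.2, hij])).elim
        · exact hdis k l h hkl
      · obtain ⟨⟨x, y⟩, hxy, hxyR⟩ := not_subset.1 (hbox (V' i) (V' j) (hV' i).1 (hV' j).1
          (hV' i).2.1 (hV' j).2.1 ((hV' i).2.2.trans (hV i).2.2) ((hV' j).2.2.trans (hV j).2.2))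
        obtain ⟨P, Q, hP, hQ, hxP, hyQ, hPQ⟩ := isOpen_prod_iff.1 hR.isOpen_compl x y hxyR
        let V'' : ι → Set X := fun k => if k = i then V' i ∩ P else if k = j then V' j ∩ Q else V' k
        have hi : V'' i = V' i ∩ P := if_pos rfl
        have hj : V'' j = V' j ∩ Q := by simp [V'', Ne.symm hij]
        have hsub : ∀ k, V'' k ⊆ V' k := fun k => by
          dsimp only [V'']
          split_ifs with h1 h2
          · exact h1 ▸ inter_subset_left
          · exact h2 ▸ inter_subset_left
          · exact le_rfl
        refine ⟨V'', fun k => ⟨?_, ?_, (hsub k).trans (hV' k).2.2⟩, fun k l h hkl => ?_⟩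
        · dsimp only [V'']
          split_ifs
          exacts [(hV' i).1.inter hP, (hV' j).1.inter hQ, (hV' k).1]
        · dsimp only [V'']
          split_ifs
          exacts [⟨x, hxy.1, hxP⟩, ⟨y, hxy.2, hyQ⟩, (hV' k).2.1]
        · rcases h with h | h
          · simp only [Prod.mk.injEq] at h
            rw [h.1, h.2, hi, hj]
            exact disjoint_left.2 fun z hz hzR => hPQ ⟨hz.1.2, hz.2.2⟩ hzR
          · exact (hdis k l h hkl).mono_left (prod_mono (hsub k) (hsub l))
  obtain ⟨V', h1, h2⟩ := key univ
  exact ⟨V', h1, fun i j => h2 i j trivial⟩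

theorem exists_open_closure_subset {X : Type*} [TopologicalSpace X] [RegularSpace X] {V : Set X}
    (hV : IsOpen V) (hne : V.Nonempty) :
    ∃ V' : Set X, IsOpen V' ∧ V'.Nonempty ∧ closure V' ⊆ V := by
  obtain ⟨x, hx⟩ := hne
  obtain ⟨K, hK, hKc, hKV⟩ := exists_mem_nhds_isClosed_subset (hV.mem_nhds hx)
  exact ⟨interior K, isOpen_interior, ⟨x, mem_interior_iff_mem_nhds.2 hK⟩,
    (closure_minimal interior_subset hKc).trans hKV⟩

/-- Mycielski's theorem: countably many closed relations that contain no open box have a common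
independent set of cardinality continuum. -/
theorem exists_independent_cantor {X : Type*} [TopologicalSpace X] [CompactSpace X]
    [RegularSpace X] {W : Set X} (hW : IsOpen W) (hWne : W.Nonempty) {F : ℕ → Set (X × X)}
    (hF : ∀ m, IsClosed (F m))
    (hbox : ∀ m, ∀ P Q : Set X, IsOpen P → IsOpen Q → P.Nonempty → Q.Nonempty → P ⊆ W → Q ⊆ W →
      ¬ P ×ˢ Q ⊆ F m) :
    ∃ f : (ℕ → Bool) → X, (∀ a, f a ∈ W) ∧ ∀ a b, a ≠ b → ∀ m, (f a, f b) ∉ F m := by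
  -- finite unions of the relations contain no open box either
  have hfin : ∀ n, ∀ P Q : Set X, IsOpen P → IsOpen Q → P.Nonempty → Q.Nonempty → P ⊆ W → Q ⊆ W →
      ∃ P' Q' : Set X, IsOpen P' ∧ IsOpen Q' ∧ P'.Nonempty ∧ Q'.Nonempty ∧ P' ⊆ P ∧ Q' ⊆ Q ∧
        Disjoint (P' ×ˢ Q') (⋃ m ∈ Iio n, F m) := by
    intro n P Q hP hQ hPne hQne hPW hQW
    induction n with
    | zero => exact ⟨P, Q, hP, hQ, hPne, hQne, le_rfl, le_rfl, by simp⟩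
    | succ n ih =>
      obtain ⟨P', Q', hP', hQ', hPne', hQne', hPP, hQQ, hdis⟩ := ih
      obtain ⟨⟨x, y⟩, hxy, hxyR⟩ := not_subset.1 (hbox n P' Q' hP' hQ' hPne' hQne'
        (hPP.trans hPW) (hQQ.trans hQW))
      obtain ⟨A, B, hA, hB, hxA, hyB, hAB⟩ := isOpen_prod_iff.1 (hF n).isOpen_compl x y hxyR
      refine ⟨P' ∩ A, Q' ∩ B, hP'.inter hA, hQ'.inter hB, ⟨x, hxy.1, hxA⟩, ⟨y, hxy.2, hyB⟩,
        inter_subset_left.trans hPP, inter_subset_left.trans hQQ, ?_⟩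
      refine disjoint_left.2 fun z hz hzF => ?_
      simp only [mem_iUnion, mem_Iio, Nat.lt_succ_iff_lt_or_eq] at hzF
      obtain ⟨m, hm | rfl, hzm⟩ := hzF
      · exact disjoint_left.1 hdis ⟨hz.1.1, hz.2.1⟩ (mem_biUnion (by exact hm) hzm)
      · exact hAB ⟨hz.1.2, hz.2.2⟩ hzm
  have hstep : ∀ n, ∀ V : (Fin n → Bool) → Set X,
      (∀ s, IsOpen (V s) ∧ (V s).Nonempty ∧ V s ⊆ W) →
      ∃ V' : (Fin (n + 1) → Bool) → Set X, (∀ s, IsOpen (V' s) ∧ (V' s).Nonempty ∧ V' s ⊆ W) ∧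
        (∀ s, closure (V' s) ⊆ V fun i => s i.castSucc) ∧
        ∀ s t, s ≠ t → Disjoint (V' s ×ˢ V' t) (⋃ m ∈ Iio (n + 1), F m) := by
    intro n V hV
    obtain ⟨V₁, h1, h2⟩ := exists_shrink_avoiding (W := W) (R := ⋃ m ∈ Iio (n + 1), F m)
      ((finite_Iio _).isClosed_biUnion fun m _ => hF m)
      (fun P Q hP hQ hPne hQne hPW hQW hsub => by
        obtain ⟨P', Q', -, -, ⟨x, hx⟩, ⟨y, hy⟩, hPP, hQQ, hdis⟩ :=
          hfin (n + 1) P Q hP hQ hPne hQne hPW hQW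
        exact disjoint_left.1 hdis (mk_mem_prod hx hy) (hsub ⟨hPP hx, hQQ hy⟩))
      (fun s : Fin (n + 1) → Bool => V fun i => s i.castSucc) (fun s => hV _)
    choose V₂ h3 h4 h5 using fun s => exists_open_closure_subset (h1 s).1 (h1 s).2.1
    refine ⟨V₂, fun s => ⟨h3 s, h4 s, subset_closure.trans ((h5 s).trans
      ((h1 s).2.2.trans (hV _).2.2))⟩, fun s => (h5 s).trans (h1 s).2.2, fun s t hst => ?_⟩
    exact (h2 s t hst).mono_left
      (prod_mono (subset_closure.trans (h5 s)) (subset_closure.trans (h5 t)))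
  choose! g hg1 hg2 hg3 using hstep
  let V : (n : ℕ) → (Fin n → Bool) → Set X := fun n => Nat.rec (fun _ => W) (fun n v => g n v) n
  have hV : ∀ n, ∀ s, IsOpen (V n s) ∧ (V n s).Nonempty ∧ V n s ⊆ W := by
    intro n
    induction n with
    | zero => exact fun s => ⟨hW, hWne, le_rfl⟩
    | succ n ih => exact hg1 n (V n) ih
  obtain ⟨f, hf⟩ := exists_branch_points (fun n s => closure (V n s)) (fun n s => isClosed_closure)
    (fun n s => (hV n s).2.1.closure)
    (fun n s => (hg2 n (V n) (hV n) s).trans subset_closure)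
  have hfV : ∀ a n, f a ∈ V n fun i => a i := fun a n => hg2 n (V n) (hV n) _ (hf a (n + 1))
  refine ⟨f, fun a => hfV a 0, fun a b hab m hm => ?_⟩
  obtain ⟨N, hN⟩ := restrict_ne_of_ne hab
  -- Level `N + m + 1` lies past the splitting of the branches and already avoids `F m`.
  exact disjoint_left.1 (hg3 (N + m) (V (N + m)) (hV _) _ _ (hN _ (by omega)))
    (mk_mem_prod (hfV a (N + m + 1)) (hfV b (N + m + 1)))
    (mem_biUnion (by simp) hm)

/-! ### First case: an open set contained in every continuum with interior points in it -/

/-- The relation of lying in a common continuum that misses `B`. -/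
def joinedOutside {X : Type*} [TopologicalSpace X] (B : Set X) : Set (X × X) :=
  {p | ∃ L, IsClosed L ∧ IsPreconnected L ∧ p.1 ∈ L ∧ p.2 ∈ L ∧ Disjoint L B}

/-- The relation is equality of components in the compact space `Bᶜ`, whose space of components is
Hausdorff. -/
theorem isClosed_joinedOutside {X : Type*} [TopologicalSpace X] [CompactSpace X] [T2Space X]
    {B : Set X} (hB : IsOpen B) : IsClosed (joinedOutside B) := by
  have hBc : IsClosed Bᶜ := hB.isClosed_compl
  have : CompactSpace (Bᶜ : Set X) := isCompact_iff_compactSpace.1 hBc.isCompact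
  have h1 : IsClosed {p : (Bᶜ : Set X) × (Bᶜ : Set X) |
      (p.1 : ConnectedComponents (Bᶜ : Set X)) = p.2} :=
    isClosed_eq (ConnectedComponents.continuous_coe.comp continuous_fst)
      (ConnectedComponents.continuous_coe.comp continuous_snd)
  have h2 := (hBc.isClosedEmbedding_subtypeVal.prodMap
    hBc.isClosedEmbedding_subtypeVal).isClosedMap _ h1
  convert h2 using 1
  ext ⟨x, y⟩
  constructor
  · rintro ⟨L, -, hL', hx, hy, hLB⟩
    have hLB' : L ⊆ Bᶜ := fun z hz hzB => disjoint_left.1 hLB hz hzB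
    refine ⟨(⟨x, hLB' hx⟩, ⟨y, hLB' hy⟩), ?_, rfl⟩
    refine ConnectedComponents.coe_eq_coe'.2 ?_
    have hp : IsPreconnected ((↑) ⁻¹' L : Set (Bᶜ : Set X)) :=
      hL'.preimage_of_isClosedMap Subtype.val_injective hBc.isClosedMap_subtype_val
        (by rwa [Subtype.range_coe])
    exact hp.subset_connectedComponent (x := ⟨y, hLB' hy⟩) hy
      (show (⟨x, hLB' hx⟩ : (Bᶜ : Set X)) ∈ (↑) ⁻¹' L from hx)
  · rintro ⟨⟨a, b⟩, hab, h⟩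
    simp only [Prod.map_apply, Prod.mk.injEq] at h
    obtain ⟨rfl, rfl⟩ := h
    refine ⟨(↑) '' connectedComponent b,
      hBc.isClosedMap_subtype_val _ isClosed_connectedComponent,
      isPreconnected_connectedComponent.image _ continuous_subtype_val.continuousOn,
      mem_image_of_mem _ (ConnectedComponents.coe_eq_coe'.1 hab),
      mem_image_of_mem _ mem_connectedComponent, ?_⟩
    rintro s hs1 hs2 z hz
    obtain ⟨w, -, rfl⟩ := hs1 hz
    exact (w.2 (hs2 hz)).elim

/-- If every continuum with interior points in `W` contains `W`, then there is a Cantor set of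
points no two of which lie in a common nowhere dense continuum. -/
theorem exists_cantor_of_forall_superset {X : Type*} [MetricSpace X] [CompactSpace X] {W : Set X}
    (hW : IsOpen W) (hWne : W.Nonempty)
    (h : ∀ K : Set X, IsClosed K → IsPreconnected K → (interior K ∩ W).Nonempty → W ⊆ K) :
    ∃ f : (ℕ → Bool) → X, ∀ a b, a ≠ b → ∀ L : Set X, IsClosed L → IsPreconnected L →
      f a ∈ L → f b ∈ L → ¬ IsNowhereDense L := by
  obtain ⟨b, hbc, -, hb⟩ := TopologicalSpace.exists_countable_basis X
  have hcount : {B ∈ b | B ⊆ W ∧ B.Nonempty}.Countable := hbc.mono (sep_subset _ _)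
  have hsmall : ∀ V : Set X, IsOpen V → V.Nonempty → V ⊆ W →
      ∃ B ∈ {B ∈ b | B ⊆ W ∧ B.Nonempty}, B ⊆ V := by
    rintro V hV ⟨x, hx⟩ hVW
    obtain ⟨B, hB, hxB, hBV⟩ := hb.exists_subset_of_mem_open hx hV
    exact ⟨B, ⟨hB, hBV.trans hVW, x, hxB⟩, hBV⟩
  obtain ⟨B₀, hB₀, -⟩ := hsmall W hW hWne le_rfl
  obtain ⟨e, he⟩ := hcount.exists_eq_range ⟨B₀, hB₀⟩
  have heW : ∀ m, e m ∈ b ∧ e m ⊆ W ∧ (e m).Nonempty := fun m => by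
    have : e m ∈ range e := mem_range_self m
    rwa [← he] at this
  obtain ⟨f, hfW, hf⟩ := exists_independent_cantor hW hWne (F := fun m => joinedOutside (e m))
    (fun m => isClosed_joinedOutside (hb.isOpen (heW m).1)) (by
      rintro m P Q hP hQ ⟨x, hx⟩ ⟨y, hy⟩ hPW hQW hPQ
      -- If `P ×ˢ Q` lay in the relation, the component of `x` off `e m` would be a continuum
      -- containing `Q`, hence `W`, hence `e m` itself.
      have hcl : IsClosed (connectedComponentIn (e m)ᶜ x) := by
        obtain ⟨L, -, hL', hxL, -, hLe⟩ := hPQ (mk_mem_prod hx hy)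
        refine isClosed_of_closure_subset (isPreconnected_connectedComponentIn.closure
          |>.subset_connectedComponentIn (subset_closure (mem_connectedComponentIn
            (disjoint_left.1 hLe hxL))) (closure_minimal (connectedComponentIn_subset _ _)
              (hb.isOpen (heW m).1).isClosed_compl))
      have hQK : Q ⊆ connectedComponentIn (e m)ᶜ x := fun z hz => by
        obtain ⟨L, -, hL', hxL, hzL, hLe⟩ := hPQ (mk_mem_prod hx hz)
        exact hL'.subset_connectedComponentIn hxL
          (fun w hw hwe => disjoint_left.1 hLe hw hwe) hzL
      have hWK := h _ hcl isPreconnected_connectedComponentIn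
        ⟨y, interior_maximal hQK hQ hy, hQW hy⟩
      obtain ⟨z, hz⟩ := (heW m).2.2
      exact connectedComponentIn_subset _ _ (hWK ((heW m).2.1 hz)) hz)
  refine ⟨f, fun a b hab L hL hL' ha hb hnd => ?_⟩
  obtain ⟨x, hxW, hxL⟩ : ∃ x ∈ W, x ∉ L := by
    by_contra! hWL
    have := interior_maximal (show W ⊆ closure L from fun x hx => subset_closure (hWL x hx)) hW
    rw [IsNowhereDense] at hnd
    rw [hnd] at this
    exact this hWne.some_mem
  obtain ⟨B, hB, hBV⟩ := hsmall (W \ L) (hW.sdiff hL) ⟨x, hxW, hxL⟩ sdiff_subset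
  rw [he] at hB
  obtain ⟨m, rfl⟩ := hB
  exact hf a b hab m ⟨L, hL, hL', ha, hb, disjoint_left.2 fun z hz hze => (hBV hze).2 hz⟩

/-! ### Second case: splitting continua -/

/-- Two subcontinua of `K`, each with interior points in `W` outside of the other. -/
theorem ChainSeq.exists_two_subcontinua {X : Type*} [MetricSpace X] [CompactSpace X]
    {U : ℕ → ℕ → Set X} (hU : ChainSeq U)
    (hsplit : ∀ W : Set X, IsOpen W → W.Nonempty → ∃ K : Set X, IsClosed K ∧ IsPreconnected K ∧
      (interior K ∩ W).Nonempty ∧ ¬ W ⊆ K)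
    {K W : Set X} (hK : IsClosed K) (hK' : IsPreconnected K) (hW : IsOpen W) (hWne : W.Nonempty)
    (hWK : W ⊆ K) :
    ∃ K₁ K₂ O₁ O₂ : Set X, (IsClosed K₁ ∧ IsPreconnected K₁ ∧ K₁ ⊆ K) ∧
      (IsClosed K₂ ∧ IsPreconnected K₂ ∧ K₂ ⊆ K) ∧
      (IsOpen O₁ ∧ O₁.Nonempty ∧ O₁ ⊆ K₁ ∧ O₁ ⊆ W ∧ Disjoint O₁ K₂) ∧
      (IsOpen O₂ ∧ O₂.Nonempty ∧ O₂ ⊆ K₂ ∧ O₂ ⊆ W ∧ Disjoint O₂ K₁) := by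
  obtain ⟨N, hN, hN', hNW, hWN⟩ := hsplit W hW hWne
  obtain ⟨A, B, ⟨hA, hA', hAK, hAN⟩, ⟨hB, hB', hBK, hBN⟩, hAB⟩ := hU.exists_diff_subset_union
    hK hK' hN hN' (hNW.mono (inter_subset_left.trans interior_subset))
  have main : ∀ A V : Set X, IsClosed A → IsPreconnected A → A ⊆ K → Disjoint A (interior N) →
      IsOpen V → V.Nonempty → V ⊆ W \ N → V ⊆ A →
      ∃ K₁ K₂ O₁ O₂ : Set X, (IsClosed K₁ ∧ IsPreconnected K₁ ∧ K₁ ⊆ K) ∧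
      (IsClosed K₂ ∧ IsPreconnected K₂ ∧ K₂ ⊆ K) ∧
      (IsOpen O₁ ∧ O₁.Nonempty ∧ O₁ ⊆ K₁ ∧ O₁ ⊆ W ∧ Disjoint O₁ K₂) ∧
      (IsOpen O₂ ∧ O₂.Nonempty ∧ O₂ ⊆ K₂ ∧ O₂ ⊆ W ∧ Disjoint O₂ K₁) := by
    intro A V hA hA' hAK hAN hV hVne hVW hVA
    refine ⟨K ∩ N, A, interior N ∩ W, V,
      ⟨hK.inter hN, hU.isPreconnected_inter hK hK' hN hN', inter_subset_left⟩,
      ⟨hA, hA', hAK⟩, ⟨isOpen_interior.inter hW, hNW,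
        fun x hx => ⟨hWK hx.2, interior_subset hx.1⟩, inter_subset_right,
        hAN.symm.mono_left inter_subset_left⟩,
      ⟨hV, hVne, hVA, hVW.trans sdiff_subset, disjoint_left.2 fun x hx hxN => (hVW hx).2 hxN.2⟩⟩
  -- One piece is `K ∩ N`; the other is `A` or `B`, whichever visibly contains a nonempty open part
  -- of `W \ N`.
  by_cases hWA : W \ N ⊆ A
  · exact main A (W \ N) hA hA' hAK hAN (hW.sdiff hN) (sdiff_nonempty.2 hWN) le_rfl hWA
  · refine main B ((W \ N) \ A) hB hB' hBK hBN ((hW.sdiff hN).sdiff hA) (sdiff_nonempty.2 hWA)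
      sdiff_subset fun x hx => ?_
    exact (hAB ⟨hWK hx.1.1, hx.1.2⟩).resolve_left hx.2

/-- No nowhere dense continuum meets both sets. -/
def NotThinlyJoined {X : Type*} [TopologicalSpace X] (K₁ K₂ : Set X) : Prop :=
  ∀ L : Set X, IsClosed L → IsPreconnected L → (L ∩ K₁).Nonempty → (L ∩ K₂).Nonempty →
    ¬ IsNowhereDense L

theorem NotThinlyJoined.symm {X : Type*} [TopologicalSpace X] {K₁ K₂ : Set X}
    (h : NotThinlyJoined K₁ K₂) : NotThinlyJoined K₂ K₁ :=
  fun L hL hL' h1 h2 => h L hL hL' h2 h1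

/-- Among three continua that are ordered, a continuum joining the outer ones contains what is
private to the middle one. -/
theorem notThinlyJoined_of_order {X R : Type*} [TopologicalSpace X] [LinearOrder R] {φ : X → R}
    (hφ : ∀ L : Set X, IsClosed L → IsPreconnected L →
      ∀ x ∈ L, ∀ y ∈ L, ∀ z, φ x ≤ φ z → φ z ≤ φ y → z ∈ L)
    {K₁ K₂ K₃ O : Set X} (h1 : IsClosed K₁ ∧ IsPreconnected K₁) (h2 : IsClosed K₂ ∧ IsPreconnected K₂)
    (h3 : IsClosed K₃ ∧ IsPreconnected K₃) (hO : IsOpen O) (hO1 : Disjoint O K₁) (hO2 : O ⊆ K₂)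
    (hO3 : Disjoint O K₃) {x y z : X} (hx : x ∈ K₁) (hxK : x ∉ K₂) (hy : y ∈ O)
    (hz : z ∈ K₃) (hzK : z ∉ K₂) (hxy : φ x ≤ φ y) (hyz : φ y ≤ φ z) :
    NotThinlyJoined K₁ K₃ := by
  rintro L hL hL' hL1 hL3 hnd
  have hOL : O ⊆ L := by
    intro w hw
    -- Were `w` outside the interval from `x` to `z`, convexity of `K₂` would capture `x` or `z`.
    have hxw : φ x ≤ φ w := by
      by_contra! hlt
      exact hxK (hφ K₂ h2.1 h2.2 w (hO2 hw) y (hO2 hy) x hlt.le hxy)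
    have hwz : φ w ≤ φ z := by
      by_contra! hlt
      exact hzK (hφ K₂ h2.1 h2.2 y (hO2 hy) w (hO2 hw) z hyz hlt.le)
    have hM : IsPreconnected (K₁ ∪ L ∪ K₃) := by
      obtain ⟨p, hp⟩ := hL1
      obtain ⟨q, hq⟩ := hL3
      exact (h1.2.union p hp.2 hp.1 hL').union q (Or.inr hq.1) hq.2 h3.2
    rcases hφ _ ((h1.1.union hL).union h3.1) hM x (Or.inl (Or.inl hx)) z (Or.inr hz) w hxw hwz
      with (hw' | hw') | hw'
    · exact (disjoint_left.1 hO1 hw hw').elim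
    · exact hw'
    · exact (disjoint_left.1 hO3 hw hw').elim
  have := interior_maximal (hOL.trans subset_closure) hO
  rw [IsNowhereDense] at hnd
  rw [hnd] at this
  exact this hy

/-- Splitting `K`, and then one of its pieces, gives three continua with private open sets. Of
points chosen in these sets one lies between the others, and the two outer continua are not thinly
joined. -/
theorem ChainSeq.exists_notThinlyJoined {X : Type*} [MetricSpace X] [CompactSpace X]
    {U : ℕ → ℕ → Set X} (hU : ChainSeq U)
    (hsplit : ∀ W : Set X, IsOpen W → W.Nonempty → ∃ K : Set X, IsClosed K ∧ IsPreconnected K ∧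
      (interior K ∩ W).Nonempty ∧ ¬ W ⊆ K)
    {K : Set X} (hK : IsClosed K) (hK' : IsPreconnected K) (hKne : (interior K).Nonempty) :
    ∃ g : Bool → Set X, (∀ i, IsClosed (g i) ∧ IsPreconnected (g i) ∧ (interior (g i)).Nonempty ∧
      g i ⊆ K) ∧ NotThinlyJoined (g false) (g true) := by
  obtain ⟨R, _, φ, hφ⟩ := hU.exists_convex_order
  obtain ⟨K₀, K₃, O₀, O₃, ⟨hK0, hK0', hK0K⟩, ⟨hK3, hK3', hK3K⟩, ⟨hO0, hO0ne, hO0K, -, hO0K3⟩,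
    ⟨hO3, ⟨z, hz⟩, hO3K, -, hO3K0⟩⟩ :=
    hU.exists_two_subcontinua hsplit hK hK' isOpen_interior hKne interior_subset
  obtain ⟨K₁, K₂, O₁, O₂, ⟨hK1, hK1', hK1K⟩, ⟨hK2, hK2', hK2K⟩, ⟨hO1, ⟨x, hx⟩, hO1K, hO1W, hO1K2⟩,
    ⟨hO2, ⟨y, hy⟩, hO2K, hO2W, hO2K1⟩⟩ :=
    hU.exists_two_subcontinua hsplit hK0 hK0' hO0 hO0ne hO0K
  have hO1K3 : Disjoint O₁ K₃ := hO0K3.mono_left hO1W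
  have hO2K3 : Disjoint O₂ K₃ := hO0K3.mono_left hO2W
  have hO3K1 : Disjoint O₃ K₁ := hO3K0.mono_right hK1K
  have hO3K2 : Disjoint O₃ K₂ := hO3K0.mono_right hK2K
  have hi1 : (interior K₁).Nonempty := ⟨x, interior_maximal hO1K hO1 hx⟩
  have hi2 : (interior K₂).Nonempty := ⟨y, interior_maximal hO2K hO2 hy⟩
  have hi3 : (interior K₃).Nonempty := ⟨z, interior_maximal hO3K hO3 hz⟩
  have pair : ∀ A B : Set X, IsClosed A → IsPreconnected A → (interior A).Nonempty → A ⊆ K →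
      IsClosed B → IsPreconnected B → (interior B).Nonempty → B ⊆ K → NotThinlyJoined A B →
      ∃ g : Bool → Set X, (∀ i, IsClosed (g i) ∧ IsPreconnected (g i) ∧
        (interior (g i)).Nonempty ∧ g i ⊆ K) ∧ NotThinlyJoined (g false) (g true) :=
    fun A B a1 a2 a3 a4 b1 b2 b3 b4 hAB =>
      ⟨fun i => if i then B else A, by rintro (_ | _) <;> simp [*], by simpa using hAB⟩
  have h1 := hK1K.trans hK0K
  have h2 := hK2K.trans hK0K
  have nx2 := disjoint_left.1 hO1K2 hx
  have nx3 := disjoint_left.1 hO1K3 hx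
  have ny1 := disjoint_left.1 hO2K1 hy
  have ny3 := disjoint_left.1 hO2K3 hy
  have nz1 := disjoint_left.1 hO3K1 hz
  have nz2 := disjoint_left.1 hO3K2 hz
  have c1 := And.intro hK1 hK1'
  have c2 := And.intro hK2 hK2'
  have c3 := And.intro hK3 hK3'
  -- the middle one of the three points decides which pair to take
  have m1 : NotThinlyJoined K₂ K₃ → _ := pair K₂ K₃ hK2 hK2' hi2 h2 hK3 hK3' hi3 hK3K
  have m2 : NotThinlyJoined K₁ K₃ → _ := pair K₁ K₃ hK1 hK1' hi1 h1 hK3 hK3' hi3 hK3K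
  have m3 : NotThinlyJoined K₁ K₂ → _ := pair K₁ K₂ hK1 hK1' hi1 h1 hK2 hK2' hi2 h2
  have n1 := notThinlyJoined_of_order hφ c2 c1 c3 hO1 hO1K2 hO1K hO1K3 (hO2K hy) ny1 hx (hO3K hz) nz1
  have n1' := notThinlyJoined_of_order hφ c3 c1 c2 hO1 hO1K3 hO1K hO1K2 (hO3K hz) nz1 hx (hO2K hy) ny1
  have n2 := notThinlyJoined_of_order hφ c1 c2 c3 hO2 hO2K1 hO2K hO2K3 (hO1K hx) nx2 hy (hO3K hz) nz2
  have n2' := notThinlyJoined_of_order hφ c3 c2 c1 hO2 hO2K3 hO2K hO2K1 (hO3K hz) nz2 hy (hO1K hx) nx2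
  have n3 := notThinlyJoined_of_order hφ c1 c3 c2 hO3 hO3K1 hO3K hO3K2 (hO1K hx) nx3 hz (hO2K hy) ny3
  have n3' := notThinlyJoined_of_order hφ c2 c3 c1 hO3 hO3K2 hO3K hO3K1 (hO2K hy) ny3 hz (hO1K hx) nx3
  rcases le_total (φ x) (φ y) with hxy | hxy <;> rcases le_total (φ y) (φ z) with hyz | hyz <;>
    rcases le_total (φ x) (φ z) with hxz | hxz
  · exact m2 (n2 hxy hyz)
  · exact m2 (n2 hxy hyz)
  · exact m3 (n3 hxz hyz)
  · exact m1 (n1' hxz hxy).symm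
  · exact m1 (n1 hxy hxz)
  · exact m3 (n3' hyz hxz).symm
  · exact m2 (n2' hyz hxy).symm
  · exact m2 (n2' hyz hxy).symm

/-- If no open set is contained in all continua with interior points in it, then a binary tree of
continua yields a Cantor set of points no two of which lie in a common nowhere dense continuum. -/
theorem ChainSeq.exists_cantor_of_split {X : Type*} [MetricSpace X] [CompactSpace X]
    [ConnectedSpace X] {U : ℕ → ℕ → Set X} (hU : ChainSeq U)
    (hsplit : ∀ W : Set X, IsOpen W → W.Nonempty → ∃ K : Set X, IsClosed K ∧ IsPreconnected K ∧
      (interior K ∩ W).Nonempty ∧ ¬ W ⊆ K) :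
    ∃ f : (ℕ → Bool) → X, ∀ a b, a ≠ b → ∀ L : Set X, IsClosed L → IsPreconnected L →
      f a ∈ L → f b ∈ L → ¬ IsNowhereDense L := by
  have hstep := fun (K : Set X) (h : IsClosed K ∧ IsPreconnected K ∧ (interior K).Nonempty) =>
    hU.exists_notThinlyJoined hsplit h.1 h.2.1 h.2.2
  choose! g hg hgsep using hstep
  let C : (n : ℕ) → (Fin n → Bool) → Set X := fun n =>
    Nat.rec (fun _ => univ) (fun n v s => g (v fun i => s i.castSucc) (s (Fin.last n))) n
  have hC : ∀ n s, IsClosed (C n s) ∧ IsPreconnected (C n s) ∧ (interior (C n s)).Nonempty := by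
    intro n
    induction n with
    | zero => exact fun s => ⟨isClosed_univ, isPreconnected_univ, by simp [C]⟩
    | succ n ih => exact fun s =>
        ⟨(hg _ (ih _) _).1, (hg _ (ih _) _).2.1, (hg _ (ih _) _).2.2.1⟩
  obtain ⟨f, hf⟩ := exists_branch_points C (fun n s => (hC n s).1)
    (fun n s => (hC n s).2.2.mono interior_subset) (fun n s => (hg _ (hC n _) _).2.2.2)
  refine ⟨f, fun a b hab => ?_⟩
  classical
  have hex := Function.ne_iff.1 hab
  -- At the first difference both branches share a node and enter its two children, which are not
  -- thinly joined.
  let k := Nat.find hex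
  have hk : a k ≠ b k := Nat.find_spec hex
  have hlt : (fun i : Fin k => a i) = fun i : Fin k => b i := funext fun i => by
    by_contra h
    exact Nat.find_min hex i.2 h
  have ha : f a ∈ g (C k fun i => a i) (a k) := hf a (k + 1)
  have hb : f b ∈ g (C k fun i => a i) (b k) := by rw [hlt]; exact hf b (k + 1)
  have hsep := hgsep _ (hC k fun i => a i)
  intro L hL hL' haL hbL
  generalize a k = u at hk ha
  generalize b k = v at hk hb
  cases u <;> cases v
  · exact (hk rfl).elim
  · exact hsep L hL hL' ⟨_, haL, ha⟩ ⟨_, hbL, hb⟩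
  · exact hsep L hL hL' ⟨_, hbL, hb⟩ ⟨_, haL, ha⟩
  · exact (hk rfl).elim

/-! ### Counting meager composants -/

theorem Continuum.mem_meagerComposant_self {X : Type*} [MetricSpace X] [ConnectedSpace X]
    [Nontrivial X] (x : X) : x ∈ Continuum.meagerComposant x := by
  refine mem_sUnion.2 ⟨{x}, ⟨⟨isCompact_singleton, isConnected_singleton⟩, ?_, rfl⟩, rfl⟩
  rw [IsNowhereDense, closure_singleton, interior_singleton]

/-- A compact metric space is Polish, hence a continuous image of Baire space. -/
theorem mk_le_continuum_of_compact_metric (X : Type*) [MetricSpace X] [CompactSpace X]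
    [Nonempty X] : Cardinal.mk X ≤ Cardinal.continuum := by
  obtain ⟨f, -, hf⟩ := PolishSpace.exists_nat_nat_continuous_surjective X
  simpa using Cardinal.mk_le_of_surjective (α := ULift (ℕ → ℕ)) (f := fun a => f a.down)
    (fun x => (hf x).imp' ULift.up fun _ h => h)

theorem corollary16 {X : Type*} [MetricSpace X] [CompactSpace X] [ConnectedSpace X]
    [Nontrivial X] (hX : Continuum.IsChainable X) :
    Cardinal.mk (Continuum.meagerComposants X) = Cardinal.continuum := by
  refine le_antisymm ?_ ?_
  · refine le_trans ?_ (mk_le_continuum_of_compact_metric X)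
    refine Cardinal.mk_le_of_surjective
      (f := fun x : X => (⟨Continuum.meagerComposant x, x, rfl⟩ : Continuum.meagerComposants X)) ?_
    rintro ⟨M, x, rfl⟩
    exact ⟨x, rfl⟩
  · obtain ⟨U, hU⟩ := hX.exists_chainSeq
    obtain ⟨f, hf⟩ : ∃ f : (ℕ → Bool) → X, ∀ a b, a ≠ b → ∀ L : Set X, IsClosed L →
        IsPreconnected L → f a ∈ L → f b ∈ L → ¬ IsNowhereDense L := by
      by_cases h : ∃ W : Set X, IsOpen W ∧ W.Nonempty ∧ ∀ K : Set X, IsClosed K →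
          IsPreconnected K → (interior K ∩ W).Nonempty → W ⊆ K
      · obtain ⟨W, hW, hWne, h⟩ := h
        exact exists_cantor_of_forall_superset hW hWne h
      · push Not at h
        exact hU.exists_cantor_of_split h
    have hinj : Function.Injective fun a : ULift (ℕ → Bool) =>
        (⟨Continuum.meagerComposant (f a.down), _, rfl⟩ : Continuum.meagerComposants X) := by
      rintro ⟨a⟩ ⟨b⟩ hab
      by_contra hne
      have hab' : Continuum.meagerComposant (f a) = Continuum.meagerComposant (f b) :=
        congrArg Subtype.val hab
      -- Equal composants put `f a` in that of `f b`, hence both points in one nowhere dense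
      -- continuum; that composants partition `X` is not needed.
      have hmem := Continuum.mem_meagerComposant_self (f a)
      rw [hab'] at hmem
      obtain ⟨L, ⟨hL, hnd, hbL⟩, haL⟩ := mem_sUnion.1 hmem
      exact hf a b (fun h => hne (h ▸ rfl)) L hL.1.isClosed hL.2.isPreconnected haL hbL hnd
    simpa using Cardinal.mk_le_of_injective hinj
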